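/- Let $G$ be a connected (finite-dimensional, real) Lie group and let $\Gamma$ be a discrete subgroup of $H = PSL(2,\mathbb{R}) \times G$ such that the quotient $X = \Gamma \backslash H$ of $H$ by the left translations by elements of $\Gamma$ is compact. Let $p_2 : H \to G$ be the second projection, and let $$B = \left\{ \pm\begin{pmatrix} \lambda & t \\ 0 & \lambda^{-1} \end{pmatrix} \;:\; t \in \mathbb{R},\ \lambda > 0 \right\} \subset PSL(2,\mathbb{R}).$$ A subgroup $F$ of $PSL(2,\mathbb{R})$ acts on $X$ on the right by $\Gamma (f,g) \cdot f' = \Gamma (f f', g)$ for $(f,g) \in H$ and $f' \in F$, and this action is called minimal if all its orbits are dense in $X$. Then the following three conditions are equivalent: 1. the right $B$-action on $X$ is minimal; 2. $p_2(\Gamma)$ is dense in $G$, that is, $\overline{p_2(\Gamma)} = G$; 3. the right $PSL(2,\mathbb{R})$-action on $X$ is minimal. -/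

import Mathlib

open scoped Manifold ContDiff

/-- The group `PSL(2,ℝ) = SL(2,ℝ) / {± Id}`; it carries the quotient topology. -/
abbrev PSL2R : Type := Matrix.ProjectiveSpecialLinearGroup (Fin 2) ℝ

/-- The subgroup of `SL(2,ℝ)` of all upper triangular matrices `!![l, t; 0, l⁻¹]` with `0 < l`. -/
def upperTriangularSL2R : Subgroup (Matrix.SpecialLinearGroup (Fin 2) ℝ) where
  carrier := {A | A.1 1 0 = 0 ∧ 0 < A.1 0 0}
  one_mem' := by simp
  mul_mem' := by
    rintro A C ⟨hA, hA'⟩ ⟨hC, hC'⟩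
    refine ⟨?_, ?_⟩
    · simp [Matrix.mul_apply, Fin.sum_univ_two, hA, hC]
    · simpa [Matrix.mul_apply, Fin.sum_univ_two, hA, hC] using mul_pos hA' hC'
  inv_mem' := by
    rintro A ⟨hA, hA'⟩
    have hdet : A.1 0 0 * A.1 1 1 = 1 := by
      have h := A.2
      rw [Matrix.det_fin_two, hA] at h
      linarith
    have h11 : 0 < A.1 1 1 := by
      by_contra h
      nlinarith [mul_nonneg hA'.le (neg_nonneg.2 (not_lt.1 h))]
    refine ⟨?_, ?_⟩
    · simp [Matrix.SpecialLinearGroup.coe_inv, Matrix.adjugate_fin_two, hA]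
    · simpa [Matrix.SpecialLinearGroup.coe_inv, Matrix.adjugate_fin_two] using h11

/-- The subgroup `B` of `PSL(2,ℝ)`: the image of the upper triangular matrices with positive
diagonal. -/
def subgroupB : Subgroup PSL2R :=
  upperTriangularSL2R.map
    (QuotientGroup.mk' (Subgroup.center (Matrix.SpecialLinearGroup (Fin 2) ℝ)))

/-- The quotient `Γ \ H` of a group `H` by the left translations by elements of `Γ`; its points
are the cosets `Γ h`. -/
def LeftQuotient {H : Type*} [Group H] (Γ : Subgroup H) : Type _ :=
  Quotient (QuotientGroup.rightRel Γ)

namespace LeftQuotient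

/-- The projection `h ↦ Γ h`. -/
def mk {H : Type*} [Group H] (Γ : Subgroup H) (h : H) : LeftQuotient Γ :=
  Quotient.mk (QuotientGroup.rightRel Γ) h

theorem mk_eq_mk_iff {H : Type*} [Group H] {Γ : Subgroup H} {h k : H} :
    mk Γ h = mk Γ k ↔ k * h⁻¹ ∈ Γ :=
  Quotient.eq.trans QuotientGroup.rightRel_apply

/-- The quotient topology. -/
instance {H : Type*} [Group H] [TopologicalSpace H] (Γ : Subgroup H) :
    TopologicalSpace (LeftQuotient Γ) :=
  inferInstanceAs (TopologicalSpace (Quotient (QuotientGroup.rightRel Γ)))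

/-- The right action of `F` on `Γ \ (F × G)`, given by `Γ (f, g) f' = Γ (f f', g)`, written as a
left action of the opposite group of `F`. -/
instance {F G : Type*} [Group F] [Group G] (Γ : Subgroup (F × G)) :
    MulAction Fᵐᵒᵖ (LeftQuotient Γ) where
  smul f' := Quotient.map (fun h : F × G => (h.1 * f'.unop, h.2)) (by
    intro h k hk
    have hk' : k * h⁻¹ ∈ Γ := QuotientGroup.rightRel_apply.1 hk
    refine QuotientGroup.rightRel_apply.2 ?_
    have e : ((k.1 * f'.unop, k.2) : F × G) * (h.1 * f'.unop, h.2)⁻¹ = k * h⁻¹ := by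
      ext <;> simp [mul_assoc]
    rw [e]
    exact hk')
  one_smul x := by
    induction x using Quotient.inductionOn with
    | h h => exact congrArg (mk Γ) (by simp)
  mul_smul a b x := by
    induction x using Quotient.inductionOn with
    | h h => exact congrArg (mk Γ) (by simp [mul_assoc])

theorem op_smul_mk {F G : Type*} [Group F] [Group G] (Γ : Subgroup (F × G))
    (f f' : F) (g : G) :
    MulOpposite.op f' • mk Γ (f, g) = mk Γ (f * f', g) := rfl

end LeftQuotient

/-! Only density of `p₂(Γ)` ⇒ `B`-minimality has content. The other implications follow from orbit
inclusion and from the fact that the `PSL(2,ℝ)`-orbit of `Γ·1` consists of the points `Γ(f, 1)`.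

Functions on `X` are replaced by `Γ`-saturated sets in `H`. Haar measure restricted to a fundamental
domain is finite and invariant under right translation by `PSL(2,ℝ)`, since a perfect group has
trivial modular character (`exists_rightInvariantOn`). Let `a = diag(1/2, 2)`. The union `U` of the
forward `a`-translates of an open saturated set satisfies `U a ⊆ U`, so `a` preserves `U` up to a
null set. By the Mautner phenomenon (`mem_almostStabilizer_of_tendsto_conj`) so do both unipotent
subgroups, hence all of `SL(2,ℝ)`. Density of `p₂(Γ)` then makes `U` meet every nonempty open
saturated set (`forwardOrbit_inter_nonempty`).

To pass from transitivity to every `B`-orbit, start near `x`: a nearby point is `x b v g` with `b`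
upper triangular, `v` lower unipotent and `g ∈ G` small. Moving by `aⁿ`, `n ≥ 0`, contracts `v` and
leaves `g` small, so the `B`-orbit point `x b aⁿ` stays close to the moving point and enters the
target too. -/

open MeasureTheory Filter Topology

/-! ### A finite invariant measure on saturated sets -/

section InvariantMeasure

variable {H : Type*} [Group H]

/-- A set is saturated if it is invariant under left translations by elements of `Γ`. -/
def Saturated (Γ : Subgroup H) (A : Set H) : Prop :=
  ∀ γ ∈ Γ, ∀ x, γ * x ∈ A ↔ x ∈ A

theorem Saturated.preimage_mul_right {Γ : Subgroup H} {A : Set H} (hA : Saturated Γ A) (h : H) :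
    Saturated Γ {x | x * h ∈ A} := fun γ hγ x => by
  simpa [mul_assoc] using hA γ hγ (x * h)

theorem Saturated.diff {Γ : Subgroup H} {A C : Set H} (hA : Saturated Γ A) (hC : Saturated Γ C) :
    Saturated Γ (A \ C) := fun γ hγ x => by
  simp [hA γ hγ x, hC γ hγ x]

theorem Saturated.inter {Γ : Subgroup H} {A C : Set H} (hA : Saturated Γ A) (hC : Saturated Γ C) :
    Saturated Γ (A ∩ C) := fun γ hγ x => by
  simp [hA γ hγ x, hC γ hγ x]

variable [TopologicalSpace H]

theorem continuous_leftQuotient_mk (Γ : Subgroup H) : Continuous (LeftQuotient.mk Γ) :=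
  continuous_quotient_mk'

variable [IsTopologicalGroup H]

theorem isOpenMap_leftQuotient_mk (Γ : Subgroup H) : IsOpenMap (LeftQuotient.mk Γ) := by
  intro U hU
  have e : LeftQuotient.mk Γ ⁻¹' (LeftQuotient.mk Γ '' U) = ⋃ γ : Γ, (fun x => (γ : H) * x) ⁻¹' U := by
    ext x
    simp only [Set.mem_preimage, Set.mem_image, Set.mem_iUnion]
    constructor
    · rintro ⟨u, hu, hux⟩
      have := LeftQuotient.mk_eq_mk_iff.1 hux
      exact ⟨⟨u * x⁻¹, by simpa using Γ.inv_mem this⟩, by simpa using hu⟩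
    · rintro ⟨γ, hγ⟩
      exact ⟨γ * x, hγ, LeftQuotient.mk_eq_mk_iff.2 (by simp)⟩
  change IsOpen (LeftQuotient.mk Γ ⁻¹' (LeftQuotient.mk Γ '' U))
  rw [e]
  exact isOpen_iUnion fun γ => hU.preimage (continuous_const_mul _)

theorem exists_nhds_translates_disjoint (Γ : Subgroup H) [DiscreteTopology Γ] (h : H) :
    ∃ Q ∈ 𝓝 h, ∀ γ ∈ Γ, ∀ x ∈ Q, γ * x ∈ Q → γ = 1 := by
  have h1 : ({1} : Set Γ) ∈ 𝓝 (1 : Γ) := (isOpen_discrete _).mem_nhds rfl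
  rw [nhds_subtype_eq_comap, mem_comap] at h1
  obtain ⟨N, hN, hN1⟩ := h1
  have hc : Tendsto (fun p : H × H => p.1 * p.2⁻¹) (𝓝 h ×ˢ 𝓝 h) (𝓝 1) := by
    have : Continuous (fun p : H × H => p.1 * p.2⁻¹) := by fun_prop
    simpa [nhds_prod_eq] using this.tendsto (h, h)
  obtain ⟨Q, hQ, hQN⟩ := mem_prod_same_iff.1 (hc hN)
  refine ⟨Q, hQ, fun γ hγ x hx hγx => ?_⟩
  have h2 : γ ∈ N := by simpa using hQN (Set.mk_mem_prod hγx hx)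
  have h3 : (⟨γ, hγ⟩ : Γ) ∈ ({1} : Set Γ) := hN1 h2
  simpa [Subtype.ext_iff] using h3

variable [LocallyCompactSpace H] [SecondCountableTopology H] [MeasurableSpace H] [BorelSpace H]

/-- Small open sets inject into the quotient. Compactness glues finitely many of them, each new
piece `D'` being trimmed to `D' \ ΓD`. -/
theorem exists_isFundamentalDomain_measure_lt_top (Γ : Subgroup H) [DiscreteTopology Γ]
    [CompactSpace (LeftQuotient Γ)] (μ : Measure H) [IsFiniteMeasureOnCompacts μ] :
    ∃ D : Set H, MeasurableSet D ∧ μ D < ⊤ ∧ ∀ x : H, ∃! γ : Γ, γ • x ∈ D := by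
  have hcount : Countable Γ := TopologicalSpace.separableSpace_iff_countable.1 inferInstance
  suffices hs : ∃ D : Set H, MeasurableSet D ∧ μ D < ⊤ ∧
      (∀ γ ∈ Γ, ∀ x ∈ D, γ * x ∈ D → γ = 1) ∧ Set.univ ⊆ LeftQuotient.mk Γ '' D by
    obtain ⟨D, hD, hfin, hinj, hsurj⟩ := hs
    refine ⟨D, hD, hfin, fun x => ?_⟩
    obtain ⟨d, hd, hdx⟩ := hsurj (Set.mem_univ (LeftQuotient.mk Γ x))
    have hm : d * x⁻¹ ∈ Γ := by simpa using Γ.inv_mem (LeftQuotient.mk_eq_mk_iff.1 hdx)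
    refine ⟨⟨d * x⁻¹, hm⟩, by simpa [Subgroup.smul_def] using hd, fun γ hγ => ?_⟩
    have h1 := hinj (γ * (d * x⁻¹)⁻¹) (Γ.mul_mem γ.2 (Γ.inv_mem hm)) d hd
      (by simpa [Subgroup.smul_def, mul_assoc] using hγ)
    exact Subtype.ext (mul_inv_eq_one.1 h1)
  refine isCompact_univ.induction_on (p := fun S : Set (LeftQuotient Γ) =>
    ∃ D : Set H, MeasurableSet D ∧ μ D < ⊤ ∧
      (∀ γ ∈ Γ, ∀ x ∈ D, γ * x ∈ D → γ = 1) ∧ S ⊆ LeftQuotient.mk Γ '' D)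
    ⟨∅, by simp⟩ ?_ ?_ ?_
  · rintro S T hST ⟨D, h1, h2, h3, h4⟩
    exact ⟨D, h1, h2, h3, hST.trans h4⟩
  · rintro S T ⟨D, hD, hDf, hDi, hDs⟩ ⟨D', hD', hDf', hDi', hDs'⟩
    set R : Set H := ⋃ γ : Γ, (fun x => (γ : H) * x) ⁻¹' D with hR
    have hRm : MeasurableSet R :=
      MeasurableSet.iUnion fun γ => (measurable_const_mul (γ : H)) hD
    have hmem : ∀ x, x ∈ R ↔ ∃ γ ∈ Γ, γ * x ∈ D := by simp [hR]
    refine ⟨D ∪ (D' \ R), hD.union (hD'.diff hRm), ?_, ?_, ?_⟩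
    · exact (measure_union_le _ _).trans_lt (ENNReal.add_lt_top.2
        ⟨hDf, (measure_mono Set.sdiff_subset).trans_lt hDf'⟩)
    · rintro γ hγ x (hx | ⟨hx, hxR⟩) (hy | ⟨hy, hyR⟩)
      · exact hDi γ hγ x hx hy
      · exact absurd ((hmem _).2 ⟨γ⁻¹, Γ.inv_mem hγ, by simpa using hx⟩) hyR
      · exact absurd ((hmem _).2 ⟨γ, hγ, hy⟩) hxR
      · exact hDi' γ hγ x hx hy
    · rintro y (hy | hy)
      · exact Set.image_mono Set.subset_union_left (hDs hy)
      · obtain ⟨d, hd, rfl⟩ := hDs' hy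
        by_cases hdR : d ∈ R
        · obtain ⟨γ, hγ, hγd⟩ := (hmem d).1 hdR
          exact ⟨γ * d, Or.inl hγd, LeftQuotient.mk_eq_mk_iff.2 (by simpa using hγ)⟩
        · exact ⟨d, Or.inr ⟨hd, hdR⟩, rfl⟩
  · intro y _
    obtain ⟨h, rfl⟩ : ∃ h, LeftQuotient.mk Γ h = y := Quotient.exists_rep y
    obtain ⟨Q, hQ, hQi⟩ := exists_nhds_translates_disjoint Γ h
    obtain ⟨W, hW, hWo, hWf⟩ := μ.exists_isOpen_measure_lt_top h
    obtain ⟨O, hO, hOo, hOh⟩ := mem_nhds_iff.1 (inter_mem hQ (hWo.mem_nhds hW))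
    refine ⟨LeftQuotient.mk Γ '' O, ?_, O, hOo.measurableSet, ?_, ?_, subset_rfl⟩
    · exact mem_nhdsWithin_of_mem_nhds
        ((isOpenMap_leftQuotient_mk Γ O hOo).mem_nhds ⟨h, hOh, rfl⟩)
    · exact (measure_mono fun x hx => (hO hx).2).trans_lt hWf
    · exact fun γ hγ x hx hx' => hQi γ hγ x (hO hx).1 (hO hx').1

/-- `m` gives the same mass to a saturated measurable set and to its right translate by `h⁻¹`. -/
def RightInvariantOn (Γ : Subgroup H) (m : Measure H) (h : H) : Prop :=
  ∀ A, MeasurableSet A → Saturated Γ A → m {x | x * h ∈ A} = m A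

/-- The measure is Haar measure restricted to a fundamental domain `D`. Right translation carries
`D` to another fundamental domain, and all fundamental domains give a saturated set the same mass.
-/
theorem exists_rightInvariantOn (Γ : Subgroup H) [DiscreteTopology Γ]
    [CompactSpace (LeftQuotient Γ)] :
    ∃ m : Measure H, IsFiniteMeasure m ∧
      (∀ h, Measure.modularCharacter h = 1 → RightInvariantOn Γ m h) ∧
      ∀ U : Set H, IsOpen U → U.Nonempty → Saturated Γ U → m U ≠ 0 := by
  set μ : Measure H := Measure.haar
  have hcount : Countable Γ := TopologicalSpace.separableSpace_iff_countable.1 inferInstance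
  obtain ⟨D, hD, hfin, hex⟩ := exists_isFundamentalDomain_measure_lt_top Γ μ
  have hFD : IsFundamentalDomain Γ D μ := .mk' hD.nullMeasurableSet hex
  refine ⟨μ.restrict D, ⟨by simpa using hfin⟩, fun h hh A hA hAs => ?_, fun U hU hne hUs h0 => ?_⟩
  · have hmap : μ.map (· * h) = μ := by
      have h1 : Measure.modularCharacterFun h = 1 := hh
      rw [Measure.map_right_mul_eq_modularCharacterFun_smul μ h, h1, one_smul]
    set D' : Set H := {x | x * h⁻¹ ∈ D}
    have hD' : MeasurableSet D' := (measurable_mul_const h⁻¹) hD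
    have hFD' : IsFundamentalDomain Γ D' μ := .mk' hD'.nullMeasurableSet fun x => by
      simpa [D', Subgroup.smul_def, mul_assoc] using hex (x * h⁻¹)
    have hpre : MeasurableSet {x | x * h ∈ A} := (measurable_mul_const h) hA
    rw [Measure.restrict_apply hpre, Measure.restrict_apply hA]
    have e : {x | x * h ∈ A} ∩ D = (· * h) ⁻¹' (A ∩ D') := by
      ext x; simp [D']
    rw [e, ← Measure.map_apply (measurable_mul_const h) (hA.inter hD'), hmap]
    exact hFD'.measure_set_eq hFD hA fun g => by
      ext x; exact hAs g g.2 x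
  · rw [Measure.restrict_apply hU.measurableSet] at h0
    refine hU.measure_ne_zero μ hne (hFD.measure_zero_of_invariant U (fun g => ?_) h0)
    ext x
    rw [Set.mem_smul_set_iff_inv_smul_mem]
    exact hUs _ (g⁻¹).2 x

end InvariantMeasure

/-! ### Almost invariance and the Mautner phenomenon -/

section Mautner

variable {H : Type*} [Group H] [TopologicalSpace H] [IsTopologicalGroup H]
  [MeasurableSpace H] [BorelSpace H]

/-- The elements of `K` whose right translation preserves `U` up to an `m`-null set. -/
def almostStabilizer (Γ : Subgroup H) (m : Measure H) [IsFiniteMeasure m] (K : Subgroup H)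
    (hK : ∀ h ∈ K, RightInvariantOn Γ m h) {U : Set H} (hU : IsOpen U) (hUs : Saturated Γ U) :
    Subgroup H where
  carrier := {h | h ∈ K ∧ m (U \ {x | x * h ∈ U}) = 0}
  one_mem' := ⟨K.one_mem, by simp⟩
  mul_mem' := by
    rintro a b ⟨ha, ha0⟩ ⟨hb, hb0⟩
    refine ⟨K.mul_mem ha hb, ?_⟩
    have hopen : IsOpen {x | x * b ∈ U} := hU.preimage (continuous_mul_const b)
    have h1 := hK a ha (U \ {x | x * b ∈ U}) (hU.measurableSet.diff hopen.measurableSet)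
      (hUs.diff (hUs.preimage_mul_right b))
    rw [hb0] at h1
    refine measure_mono_null (fun x hx => ?_) (measure_union_null ha0 h1)
    by_cases hxa : x * a ∈ U
    · exact Or.inr ⟨hxa, by simpa [mul_assoc] using hx.2⟩
    · exact Or.inl ⟨hx.1, hxa⟩
  inv_mem' := by
    rintro a ⟨ha, ha0⟩
    refine ⟨K.inv_mem ha, ?_⟩
    have ho (b : H) : IsOpen {x | x * b ∈ U} := hU.preimage (continuous_mul_const b)
    have h1 := hK a ha (U \ {x | x * a⁻¹ ∈ U})
      (hU.measurableSet.diff (ho _).measurableSet) (hUs.diff (hUs.preimage_mul_right _))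
    have h2 := hK a ha U hU.measurableSet hUs
    rw [← h1]
    have e : {x | x * a ∈ U \ {x | x * a⁻¹ ∈ U}} = {x | x * a ∈ U} \ U := by
      ext x; simp
    rw [e]
    -- `U` and its translate have equal finite mass, so if one difference is null, so is the other.
    have h3 := measure_sdiff_add_inter (μ := m) {x | x * a ∈ U} hU.measurableSet
    have h4 := measure_sdiff_add_inter (μ := m) U (ho a).measurableSet
    rw [ha0, zero_add, Set.inter_comm] at h4
    rw [h4, h2] at h3
    exact (ENNReal.add_left_inj (measure_ne_top m U)).1 (h3.trans (zero_add _).symm)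

variable {Γ : Subgroup H} {m : Measure H} [IsFiniteMeasure m] {K : Subgroup H}
  {hK : ∀ h ∈ K, RightInvariantOn Γ m h} {U : Set H} {hU : IsOpen U} {hUs : Saturated Γ U}

theorem mem_almostStabilizer {h : H} : h ∈ almostStabilizer Γ m K hK hU hUs ↔
    h ∈ K ∧ m (U \ {x | x * h ∈ U}) = 0 := Iff.rfl

theorem mem_almostStabilizer_of_subset {h : H} (hh : h ∈ K) (hsub : ∀ x ∈ U, x * h ∈ U) :
    h ∈ almostStabilizer Γ m K hK hU hUs := by
  refine ⟨hh, ?_⟩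
  have : U \ {x | x * h ∈ U} = ∅ := by
    ext x; simpa using hsub x
  simp [this]

/-- The Mautner phenomenon. -/
theorem mem_almostStabilizer_of_tendsto_conj {a p : H}
    (ha : a ∈ almostStabilizer Γ m K hK hU hUs) (hp : p ∈ K)
    (hlim : Tendsto (fun n : ℕ => a ^ n * p * (a ^ n)⁻¹) atTop (𝓝 1)) :
    p ∈ almostStabilizer Γ m K hK hU hUs := by
  refine ⟨hp, ?_⟩
  have ho (b : H) : IsOpen {x | x * b ∈ U} := hU.preimage (continuous_mul_const b)
  have hmeas (b : H) : MeasurableSet (U \ {x | x * b ∈ U}) :=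
    hU.measurableSet.diff (ho b).measurableSet
  have hsat (b : H) : Saturated Γ (U \ {x | x * b ∈ U}) := hUs.diff (hUs.preimage_mul_right b)
  set q : ℕ → H := fun n => a ^ n * p * (a ^ n)⁻¹
  have hbound : ∀ n, m (U \ {x | x * p ∈ U}) ≤ m (U \ {x | x * q n ∈ U}) := by
    intro n
    have han := Subgroup.pow_mem _ ha n
    have hq : q n ∈ K := K.mul_mem (K.mul_mem han.1 hp) (K.inv_mem han.1)
    have h1 := hK _ han.1 _ (hmeas (a ^ n)⁻¹) (hsat _)
    rw [(mem_almostStabilizer.1 (Subgroup.inv_mem _ han)).2] at h1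
    have h2 := hK _ hq _ (hmeas (a ^ n)) (hsat _)
    rw [han.2] at h2
    rw [← hK _ han.1 _ (hmeas p) (hsat p)]
    -- Since `aⁿ p = qₙ aⁿ`, the last two sets measure only the failure of `a⁻ⁿ` and `aⁿ` to
    -- preserve `U`, hence are null.
    have hsub : {x | x * a ^ n ∈ U \ {x | x * p ∈ U}} ⊆
        (U \ {x | x * q n ∈ U}) ∪ ({x | x * a ^ n ∈ U \ {x | x * (a ^ n)⁻¹ ∈ U}} ∪
          {x | x * q n ∈ U \ {x | x * a ^ n ∈ U}}) := by
      rintro x ⟨hx1, hx2⟩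
      by_cases hxU : x ∈ U
      · by_cases hxq : x * q n ∈ U
        · refine Or.inr (Or.inr ⟨hxq, ?_⟩)
          simpa [q, mul_assoc] using hx2
        · exact Or.inl ⟨hxU, hxq⟩
      · exact Or.inr (Or.inl ⟨hx1, by simpa using hxU⟩)
    calc _ ≤ _ := measure_mono hsub
      _ ≤ _ := measure_union_le _ _
      _ = _ := by rw [measure_union_null h1 h2, add_zero]
  -- Openness of `U` enters here: for `x ∈ U`, the points `x qₙ → x` eventually lie in `U`.
  have hto : Tendsto (fun n => m (U \ {x | x * q n ∈ U})) atTop (𝓝 (m ∅)) := by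
    refine tendsto_measure_of_tendsto_indicator_of_isFiniteMeasure _ m (fun n => hmeas _) ?_
    intro x
    simp only [Set.mem_empty_iff_false, iff_false]
    by_cases hx : x ∈ U
    · have : Tendsto (fun n => x * q n) atTop (𝓝 x) := by
        simpa using (tendsto_const_nhds (x := x)).mul hlim
      filter_upwards [this (hU.mem_nhds hx)] with n hn hn'
      exact hn'.2 hn
    · exact Eventually.of_forall fun n hn => hx hn.1
  rw [measure_empty] at hto
  exact le_antisymm (ge_of_tendsto' hto hbound) bot_le

/-- Two nonempty open saturated sets meet, if one of them is almost invariant under a subgroup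
all of whose orbits are dense modulo `Γ`. -/
theorem inter_nonempty_of_le_almostStabilizer
    (hpos : ∀ V : Set H, IsOpen V → V.Nonempty → Saturated Γ V → m V ≠ 0)
    {V : Set H} (hV : IsOpen V) (hVs : Saturated Γ V) {x p : H} (hx : x ∈ U) (hxp : x * p ∈ V)
    (hp : p ∈ almostStabilizer Γ m K hK hU hUs) : (U ∩ V).Nonempty := by
  have hpi := Subgroup.inv_mem _ hp
  have hopen : IsOpen {y | y * p⁻¹ ∈ U} := hU.preimage (continuous_mul_const _)
  by_contra hne
  -- If `U` and `V` were disjoint, the open set `V ∩ Up` would lie in the null set `Up \ U`.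
  refine hpos (V ∩ {y | y * p⁻¹ ∈ U}) (hV.inter hopen) ⟨x * p, hxp, by simpa using hx⟩
    (hVs.inter (hUs.preimage_mul_right _)) ?_
  have h1 := hK _ hpi.1 (U \ {x | x * p ∈ U})
    (hU.measurableSet.diff (hU.preimage (continuous_mul_const _)).measurableSet)
    (hUs.diff (hUs.preimage_mul_right _))
  rw [hp.2] at h1
  refine measure_mono_null (fun y hy => ?_) h1
  refine ⟨hy.2, fun hyU => hne ⟨y, ?_, hy.1⟩⟩
  simpa using hyU

end Mautner

/-! ### Unipotent and diagonal matrices in `SL(2,ℝ)` -/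

section SpecialLinear

open Matrix

instance : SecondCountableTopology (SpecialLinearGroup (Fin 2) ℝ) :=
  inferInstanceAs (SecondCountableTopology {A : Fin 2 → Fin 2 → ℝ // Matrix.det A = 1})

instance : LocallyCompactSpace (SpecialLinearGroup (Fin 2) ℝ) := by
  have h : IsClosed {A : Matrix (Fin 2) (Fin 2) ℝ | A.det = 1} :=
    isClosed_eq (by fun_prop) continuous_const
  have : LocallyCompactSpace (Matrix (Fin 2) (Fin 2) ℝ) :=
    inferInstanceAs (LocallyCompactSpace (Fin 2 → Fin 2 → ℝ))
  exact h.isClosedEmbedding_subtypeVal.locallyCompactSpace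

instance : SecondCountableTopology PSL2R :=
  inferInstanceAs (SecondCountableTopology (SpecialLinearGroup (Fin 2) ℝ ⧸ _))

instance : LocallyCompactSpace PSL2R :=
  inferInstanceAs (LocallyCompactSpace (SpecialLinearGroup (Fin 2) ℝ ⧸ _))

theorem val_mul_specialLinearGroup (A C : SpecialLinearGroup (Fin 2) ℝ) :
    (A * C).1 = A.1 * C.1 := rfl

theorem specialLinearGroup_ext {A C : SpecialLinearGroup (Fin 2) ℝ} (h : A.1 = C.1) : A = C :=
  Subtype.ext h

/-- `PSL(2,ℝ)` is perfect. This is applied to the modular character, whose target is only a monoid,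
hence the detour through units. -/
theorem monoidHom_psl2R_eq_one {M : Type*} [CommMonoid M] (f : PSL2R →* M) (p : PSL2R) :
    f p = 1 := by
  have h := SL2Simple.PSL_commutator_eq_top (F := ℝ) ⟨2, by norm_num, by norm_num⟩
  have hp : p ∈ commutator PSL2R := h ▸ Subgroup.mem_top p
  have hk := Abelianization.commutator_subset_ker f.toHomUnits hp
  simpa using congrArg Units.val (MonoidHom.mem_ker.1 hk)

/-- The upper unipotent matrix with entry `s`. -/
def upperUnipotent (s : ℝ) : SpecialLinearGroup (Fin 2) ℝ := ⟨!![1, s; 0, 1], by simp⟩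

/-- The lower unipotent matrix with entry `s`. -/
def lowerUnipotent (s : ℝ) : SpecialLinearGroup (Fin 2) ℝ := ⟨!![1, 0; s, 1], by simp⟩

/-- The diagonal matrix with entries `1 / 2` and `2`. -/
noncomputable def halfDiagonal : SpecialLinearGroup (Fin 2) ℝ :=
  ⟨!![1 / 2, 0; 0, 2], by simp⟩

theorem continuous_upperUnipotent : Continuous upperUnipotent := by
  refine Continuous.subtype_mk (continuous_matrix fun i j => ?_) _
  fin_cases i <;> fin_cases j <;> simp <;> fun_prop

theorem continuous_lowerUnipotent : Continuous lowerUnipotent := by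
  refine Continuous.subtype_mk (continuous_matrix fun i j => ?_) _
  fin_cases i <;> fin_cases j <;> simp <;> fun_prop

@[simp] theorem upperUnipotent_zero : upperUnipotent 0 = 1 := by
  ext i j; fin_cases i <;> fin_cases j <;> simp [upperUnipotent]

@[simp] theorem lowerUnipotent_zero : lowerUnipotent 0 = 1 := by
  ext i j; fin_cases i <;> fin_cases j <;> simp [lowerUnipotent]

theorem halfDiagonal_pow (n : ℕ) :
    (halfDiagonal ^ n : SpecialLinearGroup (Fin 2) ℝ).1 = !![(1 / 2) ^ n, 0; 0, 2 ^ n] := by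
  induction n with
  | zero => ext i j; fin_cases i <;> fin_cases j <;> simp
  | succ n ih =>
    rw [pow_succ, val_mul_specialLinearGroup, ih]
    ext i j; fin_cases i <;> fin_cases j <;> simp [halfDiagonal, pow_succ]

theorem halfDiagonal_pow_mul_upperUnipotent (n : ℕ) (s : ℝ) :
    halfDiagonal ^ n * upperUnipotent s * (halfDiagonal ^ n)⁻¹ =
      upperUnipotent (s * (1 / 4) ^ n) := by
  rw [mul_inv_eq_iff_eq_mul]
  apply specialLinearGroup_ext
  rw [val_mul_specialLinearGroup, val_mul_specialLinearGroup, halfDiagonal_pow]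
  have h : ((1 / 2 : ℝ)) ^ n = (1 / 4) ^ n * 2 ^ n := by rw [← mul_pow]; norm_num
  ext i j; fin_cases i <;> fin_cases j <;> simp [upperUnipotent, Matrix.mul_apply, Fin.sum_univ_two]
  simp only [one_div, inv_pow] at h
  rw [h]; ring

theorem lowerUnipotent_mul_halfDiagonal_pow (n : ℕ) (s : ℝ) :
    lowerUnipotent s * halfDiagonal ^ n = halfDiagonal ^ n * lowerUnipotent (s * (1 / 4) ^ n) := by
  apply specialLinearGroup_ext
  rw [val_mul_specialLinearGroup, val_mul_specialLinearGroup, halfDiagonal_pow]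
  have h : ((1 / 2 : ℝ)) ^ n = (1 / 4) ^ n * 2 ^ n := by rw [← mul_pow]; norm_num
  ext i j; fin_cases i <;> fin_cases j <;> simp [lowerUnipotent, Matrix.mul_apply, Fin.sum_univ_two]
  simp only [one_div, inv_pow] at h
  rw [h]; ring

theorem tendsto_mul_quarter_pow (s : ℝ) :
    Tendsto (fun n : ℕ => s * (1 / 4 : ℝ) ^ n) atTop (𝓝 0) := by
  simpa using (tendsto_pow_atTop_nhds_zero_of_lt_one (r := (1 / 4 : ℝ)) (by norm_num)
    (by norm_num)).const_mul s

theorem tendsto_conj_upperUnipotent (s : ℝ) :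
    Tendsto (fun n : ℕ => halfDiagonal ^ n * upperUnipotent s * (halfDiagonal ^ n)⁻¹) atTop
      (𝓝 1) := by
  simp_rw [halfDiagonal_pow_mul_upperUnipotent]
  rw [← upperUnipotent_zero]
  exact (continuous_upperUnipotent.tendsto 0).comp (tendsto_mul_quarter_pow s)

theorem tendsto_conj_lowerUnipotent (s : ℝ) :
    Tendsto (fun n : ℕ => halfDiagonal⁻¹ ^ n * lowerUnipotent s * (halfDiagonal⁻¹ ^ n)⁻¹) atTop
      (𝓝 1) := by
  have h (n : ℕ) : halfDiagonal⁻¹ ^ n * lowerUnipotent s * (halfDiagonal⁻¹ ^ n)⁻¹ =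
      lowerUnipotent (s * (1 / 4) ^ n) := by
    rw [inv_pow, inv_inv, mul_assoc, lowerUnipotent_mul_halfDiagonal_pow, inv_mul_cancel_left]
  simp_rw [h]
  rw [← lowerUnipotent_zero]
  exact (continuous_lowerUnipotent.tendsto 0).comp (tendsto_mul_quarter_pow s)

theorem eq_upper_mul_lower_mul_upper {A : SpecialLinearGroup (Fin 2) ℝ} (hc : A.1 1 0 ≠ 0) :
    A = upperUnipotent ((A.1 0 0 - 1) / A.1 1 0) * lowerUnipotent (A.1 1 0) *
      upperUnipotent ((A.1 1 1 - 1) / A.1 1 0) := by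
  have hdet := A.2
  rw [Matrix.det_fin_two] at hdet
  apply specialLinearGroup_ext
  rw [val_mul_specialLinearGroup, val_mul_specialLinearGroup]
  ext i j; fin_cases i <;> fin_cases j <;>
    simp [upperUnipotent, lowerUnipotent, Matrix.mul_apply, Fin.sum_univ_two] <;> field_simp <;>
    linarith

/-- The unipotent matrices generate `SL(2, ℝ)`. -/
theorem eq_top_of_unipotent_mem {S : Subgroup (SpecialLinearGroup (Fin 2) ℝ)}
    (hu : ∀ s, upperUnipotent s ∈ S) (hl : ∀ s, lowerUnipotent s ∈ S) : S = ⊤ := by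
  have key : ∀ A : SpecialLinearGroup (Fin 2) ℝ, A.1 1 0 ≠ 0 → A ∈ S := fun A hc => by
    rw [eq_upper_mul_lower_mul_upper hc]
    exact S.mul_mem (S.mul_mem (hu _) (hl _)) (hu _)
  refine (Subgroup.eq_top_iff' S).2 fun A => ?_
  by_cases hc : A.1 1 0 = 0
  · have h00 : A.1 0 0 ≠ 0 := fun h => by
      have hdet := A.2
      rw [Matrix.det_fin_two, h, hc] at hdet
      simp at hdet
    -- Adding the first row to the second makes the lower left entry `A.1 0 0 ≠ 0`.
    have h1 : lowerUnipotent 1 * A ∈ S := key _ (by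
      rw [val_mul_specialLinearGroup]
      simpa [lowerUnipotent, Matrix.mul_apply, Fin.sum_univ_two, hc] using h00)
    exact (S.mul_mem_cancel_left (hl 1)).1 h1
  · exact key A hc

theorem exists_upperTriangular_mul_lowerUnipotent {A : SpecialLinearGroup (Fin 2) ℝ}
    (h : 0 < A.1 1 1) :
    ∃ b ∈ upperTriangularSL2R, A = b * lowerUnipotent (A.1 1 0 / A.1 1 1) := by
  have hdet := A.2
  rw [Matrix.det_fin_two] at hdet
  refine ⟨⟨!![(A.1 1 1)⁻¹, A.1 0 1; 0, A.1 1 1], by simp [h.ne']⟩, ⟨by simp, by simpa using h⟩, ?_⟩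
  apply specialLinearGroup_ext
  change A.1 = !![(A.1 1 1)⁻¹, A.1 0 1; 0, A.1 1 1] * (lowerUnipotent (A.1 1 0 / A.1 1 1)).1
  ext i j; fin_cases i <;> fin_cases j <;>
    simp [lowerUnipotent, Matrix.mul_apply, Fin.sum_univ_two]
  · field_simp
    linarith
  · field_simp

theorem halfDiagonal_mem : halfDiagonal ∈ upperTriangularSL2R :=
  ⟨by simp [halfDiagonal], by simp [halfDiagonal]⟩

end SpecialLinear

/-! ### Transitivity and minimality -/

section Minimality

open Matrix

/-- The homomorphism `SL(2, ℝ) → PSL(2, ℝ) × G`, `A ↦ (± A, 1)`. -/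
def slToProd (G : Type*) [Group G] : SpecialLinearGroup (Fin 2) ℝ →* PSL2R × G :=
  (MonoidHom.inl PSL2R G).comp
    (QuotientGroup.mk' (Subgroup.center (SpecialLinearGroup (Fin 2) ℝ)))

theorem slToProd_apply {G : Type*} [Group G] (A : SpecialLinearGroup (Fin 2) ℝ) :
    slToProd G A = ((QuotientGroup.mk A : PSL2R), 1) := rfl

theorem continuous_slToProd {G : Type*} [Group G] [TopologicalSpace G] : Continuous (slToProd G) :=
  (QuotientGroup.continuous_mk (N := Subgroup.center (SpecialLinearGroup (Fin 2) ℝ))).prodMk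
    continuous_const

variable {G : Type*} [Group G] [TopologicalSpace G] [IsTopologicalGroup G]

/-- An element of `Γ` adjusts the `G`-coordinate approximately; `SL(2,ℝ)` then corrects the other
coordinate exactly. -/
theorem exists_mul_mem_of_dense_snd {Γ : Subgroup (PSL2R × G)}
    (hd : Dense ((Γ.map (MonoidHom.snd PSL2R G) : Subgroup G) : Set G))
    {U V : Set (PSL2R × G)} (hV : IsOpen V) (hUs : Saturated Γ U)
    (hUn : U.Nonempty) (hVn : V.Nonempty) :
    ∃ x ∈ U, ∃ A, x * slToProd G A ∈ V := by
  obtain ⟨⟨f₀, g₀⟩, h₀⟩ := hUn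
  obtain ⟨⟨f₁, g₁⟩, h₁⟩ := hVn
  have hV2 : IsOpen {g | (f₁, g * g₀) ∈ V} := hV.preimage (by fun_prop)
  obtain ⟨g, hg, hgΓ⟩ := hd.inter_open_nonempty _ hV2 ⟨g₁ * g₀⁻¹, by simpa using h₁⟩
  obtain ⟨γ, hγ, rfl⟩ := hgΓ
  obtain ⟨A, hA⟩ := QuotientGroup.mk_surjective ((γ.1 * f₀)⁻¹ * f₁ : PSL2R)
  refine ⟨γ * (f₀, g₀), (hUs γ hγ _).2 h₀, A, ?_⟩
  have e : γ * (f₀, g₀) * slToProd G A = (f₁, γ.2 * g₀) := by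
    rw [slToProd_apply, hA]
    exact Prod.ext (mul_inv_cancel_left (γ.1 * f₀) f₁) (mul_one _)
  rw [e]
  exact hg

/-- The union of the right translates of `O` by the nonnegative powers of `a`. -/
def forwardOrbit {H : Type*} [Group H] (a : H) (O : Set H) : Set H :=
  ⋃ n : ℕ, {x | x * (a ^ n)⁻¹ ∈ O}

theorem mul_mem_forwardOrbit {H : Type*} [Group H] {a : H} {O : Set H} {x : H}
    (hx : x ∈ forwardOrbit a O) : x * a ∈ forwardOrbit a O := by
  obtain ⟨n, hn⟩ := Set.mem_iUnion.1 hx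
  refine Set.mem_iUnion.2 ⟨n + 1, ?_⟩
  simpa [pow_succ, mul_assoc] using hn

theorem dense_snd_of_isMinimal {Γ : Subgroup (PSL2R × G)}
    (h : MulAction.IsMinimal PSL2Rᵐᵒᵖ (LeftQuotient Γ)) :
    Dense ((Γ.map (MonoidHom.snd PSL2R G) : Subgroup G) : Set G) := by
  refine dense_iff_inter_open.2 fun V hV ⟨v, hv⟩ => ?_
  have hopen := isOpenMap_leftQuotient_mk Γ _ (hV.preimage (continuous_snd (X := PSL2R)))
  obtain ⟨_, ⟨w, hw, hwe⟩, ⟨f, rfl⟩⟩ := (h.dense_orbit (LeftQuotient.mk Γ 1)).inter_open_nonempty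
    _ hopen ⟨_, (1, v), hv, rfl⟩
  have he : LeftQuotient.mk Γ w = LeftQuotient.mk Γ (1 * f.unop, 1) := hwe
  have hΓ := Γ.inv_mem (LeftQuotient.mk_eq_mk_iff.1 he)
  exact ⟨w.2, hw, _, hΓ, by simp⟩

/-- Near the identity every element is of the form `(b v, g)` with `b` upper triangular with
positive diagonal and `v` lower unipotent, where `v` and `g` are small, uniformly under contraction
of `v` by the diagonal semigroup. -/
theorem exists_open_subset_upperTriangular_mul {W : Set (PSL2R × G)} (hW : W ∈ 𝓝 1) :
    ∃ Q : Set (PSL2R × G), IsOpen Q ∧ 1 ∈ Q ∧ ∀ q ∈ Q, ∃ b ∈ upperTriangularSL2R, ∃ s : ℝ,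
      ∃ g : G, q = slToProd G (b * lowerUnipotent s) * (1, g) ∧
        ∀ n : ℕ, (slToProd G (lowerUnipotent (s * (1 / 4) ^ n)) * (1, g))⁻¹ ∈ W := by
  have hc : Continuous fun p : ℝ × G => (slToProd G (lowerUnipotent p.1) * (1, p.2))⁻¹ :=
    (((continuous_slToProd.comp continuous_lowerUnipotent).comp continuous_fst).mul
      (by fun_prop)).inv
  have h0 : (slToProd G (lowerUnipotent 0) * (1, 1))⁻¹ = 1 := by simp
  have hpre : (fun p : ℝ × G => (slToProd G (lowerUnipotent p.1) * (1, p.2))⁻¹) ⁻¹' W ∈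
      𝓝 ((0 : ℝ), (1 : G)) := hc.continuousAt.preimage_mem_nhds (by dsimp only; rwa [h0])
  obtain ⟨S, hS, N, hN, hSN⟩ := mem_nhds_prod_iff.1 hpre
  have hmem : ∀ s ∈ S, ∀ g ∈ N, (slToProd G (lowerUnipotent s) * (1, g))⁻¹ ∈ W :=
    fun s hs g hg => by
      have h := hSN (Set.mk_mem_prod hs hg)
      rwa [Set.mem_preimage] at h
  obtain ⟨ε, hε, hεS⟩ := Metric.mem_nhds_iff.1 hS
  obtain ⟨N', hN'N, hN'o, hN'1⟩ := mem_nhds_iff.1 hN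
  -- The lower unipotent factor of `A` has entry `A.1 1 0 / A.1 1 1`, here kept below `ε` in
  -- absolute value.
  set R : Set (SpecialLinearGroup (Fin 2) ℝ) := {A | 0 < A.1 1 1 ∧ |A.1 1 0| < ε * A.1 1 1}
  have hent (i j : Fin 2) : Continuous fun A : SpecialLinearGroup (Fin 2) ℝ => A.1 i j :=
    continuous_subtype_val.matrix_elem i j
  have hR : IsOpen R := (isOpen_lt continuous_const (hent 1 1)).inter
    (isOpen_lt (hent 1 0).abs (continuous_const.mul (hent 1 1)))
  have hR1 : (1 : SpecialLinearGroup (Fin 2) ℝ) ∈ R := ⟨by simp, by simpa using hε⟩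
  have hmk : IsOpen ((QuotientGroup.mk : _ → PSL2R) '' R) := QuotientGroup.isOpenMap_coe R hR
  have h1mk : (1 : PSL2R) ∈ (QuotientGroup.mk : _ → PSL2R) '' R :=
    ⟨1, hR1, map_one (QuotientGroup.mk' _)⟩
  refine ⟨((QuotientGroup.mk : _ → PSL2R) '' R) ×ˢ N', hmk.prod hN'o,
    Set.mem_prod.2 ⟨h1mk, hN'1⟩, ?_⟩
  rintro ⟨_, g⟩ ⟨⟨A, ⟨hA1, hA2⟩, rfl⟩, hg⟩
  obtain ⟨b, hb, hAb⟩ := exists_upperTriangular_mul_lowerUnipotent hA1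
  refine ⟨b, hb, A.1 1 0 / A.1 1 1, g, ?_, fun n => ?_⟩
  · rw [← hAb, slToProd_apply]
    ext <;> simp
  · have h1 : |A.1 1 0| / A.1 1 1 < ε := (div_lt_iff₀ hA1).2 hA2
    have h2 : |(1 / 4 : ℝ) ^ n| ≤ 1 := by
      rw [abs_of_nonneg (by positivity)]
      exact pow_le_one₀ (by norm_num) (by norm_num)
    have h3 : A.1 1 0 / A.1 1 1 * (1 / 4) ^ n ∈ S := hεS (by
      rw [mem_ball_zero_iff, Real.norm_eq_abs, abs_mul, abs_div, abs_of_pos hA1]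
      exact (mul_le_of_le_one_right (by positivity) h2).trans_lt h1)
    exact hmem _ h3 g (hN'N hg)

variable [LocallyCompactSpace G] [SecondCountableTopology G]

/-- Topological transitivity of the positive diagonal semigroup. -/
theorem forwardOrbit_inter_nonempty {Γ : Subgroup (PSL2R × G)} [DiscreteTopology Γ]
    [CompactSpace (LeftQuotient Γ)]
    (hd : Dense ((Γ.map (MonoidHom.snd PSL2R G) : Subgroup G) : Set G))
    {O V : Set (PSL2R × G)} (hO : IsOpen O) (hOs : Saturated Γ O) (hOn : O.Nonempty)
    (hV : IsOpen V) (hVs : Saturated Γ V) (hVn : V.Nonempty) :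
    (forwardOrbit (slToProd G halfDiagonal) O ∩ V).Nonempty := by
  borelize (PSL2R × G)
  obtain ⟨m, hm, hinv, hpos⟩ := exists_rightInvariantOn Γ
  set K : Subgroup (PSL2R × G) := (Measure.modularCharacter (G := PSL2R × G)).ker
  have hK : ∀ h ∈ K, RightInvariantOn Γ m h := fun h hh => hinv h (MonoidHom.mem_ker.1 hh)
  have hmemK : ∀ A, slToProd G A ∈ K := fun A => MonoidHom.mem_ker.2
    (monoidHom_psl2R_eq_one
      ((Measure.modularCharacter (G := PSL2R × G)).comp (MonoidHom.inl PSL2R G))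
      (QuotientGroup.mk A))
  set a := slToProd G halfDiagonal
  have hU : IsOpen (forwardOrbit a O) :=
    isOpen_iUnion fun n => hO.preimage (continuous_mul_const _)
  have hUs : Saturated Γ (forwardOrbit a O) := fun γ hγ x => by
    simp only [forwardOrbit, Set.mem_iUnion]
    exact exists_congr fun n => hOs.preimage_mul_right _ γ hγ x
  have hUn : (forwardOrbit a O).Nonempty := by
    obtain ⟨x, hx⟩ := hOn
    exact ⟨x, Set.mem_iUnion.2 ⟨0, by simpa using hx⟩⟩
  have ha : a ∈ almostStabilizer Γ m K hK hU hUs :=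
    mem_almostStabilizer_of_subset (hmemK _) fun x hx => mul_mem_forwardOrbit hx
  have htop : (almostStabilizer Γ m K hK hU hUs).comap (slToProd G) = ⊤ := by
    refine eq_top_of_unipotent_mem (fun s => ?_) (fun s => ?_)
    · refine mem_almostStabilizer_of_tendsto_conj ha (hmemK _) ?_
      have := (continuous_slToProd (G := G)).tendsto 1 |>.comp (tendsto_conj_upperUnipotent s)
      simpa [Function.comp_def, a] using this
    -- Conjugation by `aⁿ` expands lower unipotents, so `a⁻¹` is used instead.
    · refine mem_almostStabilizer_of_tendsto_conj (Subgroup.inv_mem _ ha) (hmemK _) ?_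
      have := (continuous_slToProd (G := G)).tendsto 1 |>.comp (tendsto_conj_lowerUnipotent s)
      simpa [Function.comp_def, a] using this
  obtain ⟨x, hx, A, hxA⟩ := exists_mul_mem_of_dense_snd hd hV hUs hUn hVn
  exact inter_nonempty_of_le_almostStabilizer (hK := hK) (hU := hU) (hUs := hUs) hpos hV hVs hx hxA
    ((Subgroup.eq_top_iff' _).1 htop A)

theorem exists_upperTriangular_mul_mem {Γ : Subgroup (PSL2R × G)} [DiscreteTopology Γ]
    [CompactSpace (LeftQuotient Γ)]
    (hd : Dense ((Γ.map (MonoidHom.snd PSL2R G) : Subgroup G) : Set G))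
    (x : PSL2R × G) {V : Set (PSL2R × G)} (hV : IsOpen V) (hVs : Saturated Γ V)
    (hVn : V.Nonempty) : ∃ b ∈ upperTriangularSL2R, x * slToProd G b ∈ V := by
  obtain ⟨v₀, hv₀⟩ := hVn
  have hmul : (fun p : (PSL2R × G) × (PSL2R × G) => p.1 * p.2) ⁻¹' V ∈ 𝓝 (v₀, 1) :=
    continuous_mul.continuousAt.preimage_mem_nhds (by simpa using hV.mem_nhds hv₀)
  obtain ⟨V₁, hV₁, W, hW, hVW⟩ := mem_nhds_prod_iff.1 hmul
  obtain ⟨V', hV'V, hV'o, hV'0⟩ := mem_nhds_iff.1 hV₁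
  obtain ⟨Q, hQ, hQ1, hQW⟩ := exists_open_subset_upperTriangular_mul hW
  have hopen {S : Set (PSL2R × G)} (hS : IsOpen S) (y : PSL2R × G) :
      IsOpen (⋃ γ : Γ, {z | y * (γ : PSL2R × G) * z ∈ S}) :=
    isOpen_iUnion fun γ => hS.preimage (continuous_const_mul _)
  have hsat (S : Set (PSL2R × G)) (y : PSL2R × G) :
      Saturated Γ (⋃ γ : Γ, {z | y * (γ : PSL2R × G) * z ∈ S}) := fun γ hγ z => by
    simp only [Set.mem_iUnion, Set.mem_ofPred_eq]
    constructor
    · rintro ⟨δ, hδ⟩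
      exact ⟨δ * ⟨γ, hγ⟩, by simpa [mul_assoc] using hδ⟩
    · rintro ⟨δ, hδ⟩
      exact ⟨δ * ⟨γ, hγ⟩⁻¹, by simpa [mul_assoc] using hδ⟩
  -- Transitivity is applied to the saturations `ΓxQ` and `ΓV'`.
  obtain ⟨z, hz, hzV⟩ := forwardOrbit_inter_nonempty hd (hopen hQ x⁻¹) (hsat Q x⁻¹)
    ⟨x, Set.mem_iUnion.2 ⟨1, by simpa using hQ1⟩⟩ (hopen hV'o 1) (hsat V' 1)
    ⟨v₀, Set.mem_iUnion.2 ⟨1, by simpa using hV'0⟩⟩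
  obtain ⟨n, hn⟩ := Set.mem_iUnion.1 hz
  obtain ⟨γ, hγ⟩ := Set.mem_iUnion.1 hn
  obtain ⟨δ, hδ⟩ := Set.mem_iUnion.1 hzV
  obtain ⟨b, hb, s, g, hq, hw⟩ := hQW _ hγ
  refine ⟨b * halfDiagonal ^ n, mul_mem hb (pow_mem halfDiagonal_mem n), ?_⟩
  have hcomm : ((1, g) : PSL2R × G) * slToProd G (halfDiagonal ^ n) =
      slToProd G (halfDiagonal ^ n) * (1, g) := by
    rw [slToProd_apply]; ext <;> simp
  -- Moving `aⁿ` leftwards past `g` and the lower unipotent divides the entry of the latter by `4ⁿ`.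
  have hγz : (γ : PSL2R × G) * z = x * slToProd G (b * halfDiagonal ^ n) *
      (slToProd G (lowerUnipotent (s * (1 / 4) ^ n)) * (1, g)) := by
    have h1 : x⁻¹ * (γ : PSL2R × G) * (z * (slToProd G halfDiagonal ^ n)⁻¹) =
      slToProd G (b * lowerUnipotent s) * (1, g) := hq
    rw [← map_pow, ← mul_assoc, mul_inv_eq_iff_eq_mul, mul_assoc _ (1, g), hcomm, ← mul_assoc,
      ← map_mul, mul_assoc b, lowerUnipotent_mul_halfDiagonal_pow, ← mul_assoc b,
      mul_assoc x⁻¹, inv_mul_eq_iff_eq_mul] at h1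
    rw [h1, map_mul]
    simp only [mul_assoc]
  have h2 : (δ : PSL2R × G) * z ∈ V' := by simpa using hδ
  have h3 := hVW (Set.mk_mem_prod (hV'V h2) (hw n))
  have h4 : (δ : PSL2R × G) * (γ : PSL2R × G)⁻¹ * (x * slToProd G (b * halfDiagonal ^ n)) ∈ V := by
    have e : x * slToProd G (b * halfDiagonal ^ n) = γ * z *
      (slToProd G (lowerUnipotent (s * (1 / 4) ^ n)) * (1, g))⁻¹ := by
      rw [hγz, mul_inv_cancel_right]
    rw [e]
    simpa [mul_assoc] using h3
  exact (hVs _ (Γ.mul_mem δ.2 (Γ.inv_mem γ.2)) _).1 h4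

theorem isMinimal_subgroupB_of_dense_snd {Γ : Subgroup (PSL2R × G)} [DiscreteTopology Γ]
    [CompactSpace (LeftQuotient Γ)]
    (hd : Dense ((Γ.map (MonoidHom.snd PSL2R G) : Subgroup G) : Set G)) :
    MulAction.IsMinimal subgroupB.op (LeftQuotient Γ) := by
  refine ⟨fun y => dense_iff_inter_open.2 fun V hV hVn => ?_⟩
  obtain ⟨x, rfl⟩ : ∃ x, LeftQuotient.mk Γ x = y := Quotient.exists_rep y
  obtain ⟨v, hv⟩ := hVn
  obtain ⟨v, rfl⟩ : ∃ x, LeftQuotient.mk Γ x = v := Quotient.exists_rep v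
  obtain ⟨b, hb, hxb⟩ := exists_upperTriangular_mul_mem hd x
    (hV.preimage (continuous_leftQuotient_mk Γ)) (fun γ hγ z => by
      have e : LeftQuotient.mk Γ (γ * z) = LeftQuotient.mk Γ z :=
        LeftQuotient.mk_eq_mk_iff.2 (by simpa using hγ)
      simp [e]) ⟨v, hv⟩
  refine ⟨_, hxb, ⟨MulOpposite.op (QuotientGroup.mk b : PSL2R), ?_⟩, ?_⟩
  · exact Subgroup.mem_op.2 ⟨b, hb, rfl⟩
  · change LeftQuotient.mk Γ (x.1 * QuotientGroup.mk b, x.2) = _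
    congr 1
    rw [slToProd_apply]
    ext <;> simp

theorem isMinimal_of_isMinimal_subgroupB {G : Type*} [Group G] [TopologicalSpace G]
    {Γ : Subgroup (PSL2R × G)} (h : MulAction.IsMinimal subgroupB.op (LeftQuotient Γ)) :
    MulAction.IsMinimal PSL2Rᵐᵒᵖ (LeftQuotient Γ) :=
  ⟨fun y => (h.dense_orbit y).mono (by rintro _ ⟨b, rfl⟩; exact ⟨b.1, rfl⟩)⟩

end Minimality

/-- `G` is a connected (finite-dimensional, real) Lie group and `Γ` is a discrete subgroup of
`PSL(2,ℝ) × G` such that the quotient `X = Γ \ (PSL(2,ℝ) × G)` is compact. -/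
theorem proposition2p3
    {E : Type*} [NormedAddCommGroup E] [NormedSpace ℝ E] [FiniteDimensional ℝ E]
    {G : Type*} [Group G] [TopologicalSpace G] [T2Space G] [SecondCountableTopology G]
    [ChartedSpace E G] [LieGroup 𝓘(ℝ, E) ∞ G] [ConnectedSpace G]
    (Γ : Subgroup (PSL2R × G)) [DiscreteTopology Γ] [CompactSpace (LeftQuotient Γ)] :
    (MulAction.IsMinimal subgroupB.op (LeftQuotient Γ) ↔
      Dense ((Γ.map (MonoidHom.snd PSL2R G) : Subgroup G) : Set G)) ∧
    (Dense ((Γ.map (MonoidHom.snd PSL2R G) : Subgroup G) : Set G) ↔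
      MulAction.IsMinimal PSL2Rᵐᵒᵖ (LeftQuotient Γ)) := by
  have : IsTopologicalGroup G := topologicalGroup_of_lieGroup 𝓘(ℝ, E) ∞
  have : ProperSpace E := FiniteDimensional.proper_real E
  have : LocallyCompactSpace G := ChartedSpace.locallyCompactSpace E G
  exact ⟨⟨fun h => dense_snd_of_isMinimal (isMinimal_of_isMinimal_subgroupB h),
      isMinimal_subgroupB_of_dense_snd⟩,
    ⟨fun h => isMinimal_of_isMinimal_subgroupB (isMinimal_subgroupB_of_dense_snd h),
      dense_snd_of_isMinimal⟩⟩
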